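/- Let $f$ be analytic and univalent (injective) in the open unit disc $\mathbb{D}=\{z\in\mathbb{C}:|z|<1\}$, with Taylor expansion $f(z)=z+a_2z^2+a_3z^3+\cdots$ at the origin (so $f(0)=0$ and $f'(0)=1$). For positive integers $q,n$ let $T_{q,n}(f)$ be the symmetric Toeplitz determinant $$T_{q,n}(f)=\det\bigl(a_{n+|i-j|}\bigr)_{1\le i,j\le q},\qquad a_1=1.$$ If $a_2=0$, then $$|T_{3,2}(f)|\le \frac43\qquad\text{and}\qquad |T_{3,3}(f)|\le 7.3883.$$ -/

import Mathlib

/-- The `n`-th Taylor coefficient `a_n` at the origin of a function `f`. -/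
noncomputable def taylorCoeff (f : ℂ → ℂ) (n : ℕ) : ℂ :=
  iteratedDeriv n f 0 / (n.factorial : ℂ)

/-- The class `𝒜`: functions analytic in the open unit disc with `f(0) = f'(0) - 1 = 0`.
Only the values of `f` on the disc matter. -/
structure ClassA (f : ℂ → ℂ) : Prop where
  analytic : DifferentiableOn ℂ f (Metric.ball 0 1)
  map_zero : f 0 = 0
  deriv_zero : deriv f 0 = 1

/-- The class `𝒮`: the functions of class `𝒜` that are univalent (injective) in the disc. -/
structure ClassS (f : ℂ → ℂ) : Prop extends ClassA f where
  univalent : Set.InjOn f (Metric.ball 0 1)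

/-- The symmetric Toeplitz determinant `T_{q,n}(f)`: the determinant of the `q × q` matrix
whose `(i, j)` entry is `a_{n + |i - j|}`. -/
noncomputable def toeplitzDet (q n : ℕ) (f : ℂ → ℂ) : ℂ :=
  (Matrix.of fun i j : Fin q => taylorCoeff f (n + ((i : ℤ) - (j : ℤ)).natAbs)).det

/-!
If `a₂ = 0` then `1/f(z) = 1/z + h(z)` with `h(z) = -a₃ z - a₄ z² + (a₃² - a₅) z³ + ⋯` holomorphic
in the disc, and `1/f` is injective on the punctured disc. Gronwall's area theorem
(`sum_mul_norm_sq_taylorCoeff_le_one`) therefore gives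
`|a₃|² + 2 |a₄|² + 3 |a₅ - a₃²|² ≤ 1` (`ClassS.area_inequality`). Both bounds are elementary
consequences, since `T_{3,2} = 2 a₃² a₄` and `T_{3,3} = (a₃ - a₅) (a₃² + a₃ a₅ - 2 a₄²)`; each factor
of the latter is at most `2 + 1/√3` in modulus.

The area theorem compares two estimates for the area of the image of an annulus `ε < |z| < r` under
`F(z) = 1/z + h(z)`, with `h(z) = b₀ + b₁ z + ⋯`. The area is the integral of `|F'|²`, which in polar
coordinates and by Bessel's inequality on each circle is at least
`π (ε⁻² - r⁻² + ∑ n |bₙ|² (r²ⁿ - ε²ⁿ))` (`le_volume_image_annulus`). For an upper bound it is not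
enough to enclose the image in a disc: `|z| = ε` is mapped nearly to an ellipse, and the term `b₁ z`
would contribute an error of order `1`. The real-linear map `w ↦ w - ε² b₁ conj w`, of determinant
`1 - ε⁴ |b₁|²`, makes this ellipse round to the next order, so that the image of the annulus lands in
a disc of radius `1/ε + O(ε²)` (`mapsTo_subMulConj_annulus`). The error now tends to `0` as `ε → 0`,
and then `r → 1`.
-/

/-! ### Taylor coefficients and circle averages -/

open Metric Real in
/-- The real part of a holomorphic function vanishing at the origin has mean zero on circles. -/
theorem circleAverage_re_eq_zero {φ : ℂ → ℂ} (hφ : DifferentiableOn ℂ φ (ball 0 1))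
    (h0 : φ 0 = 0) {ρ : ℝ} (hρ0 : 0 ≤ ρ) (hρ1 : ρ < 1) :
    circleAverage (fun z => (φ z).re) 0 ρ = 0 := by
  have hsub : closedBall (0 : ℂ) |ρ| ⊆ ball 0 1 :=
    closedBall_subset_ball (by rwa [abs_of_nonneg hρ0])
  have hc : CircleIntegrable φ 0 ρ := ContinuousOn.circleIntegrable' <|
    hφ.continuousOn.mono (sphere_subset_closedBall.trans hsub)
  have hmean : circleAverage φ 0 ρ = 0 := by
    rw [DiffContOnCl.circleAverage, h0]
    exact hφ.diffContOnCl_ball hsub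
  have := congrArg Complex.re hmean
  rw [circleAverage, Complex.smul_re, Complex.zero_re] at this
  refine Eq.trans (congrArg ((2 * π)⁻¹ • ·) ?_) this
  exact Complex.reCLM.intervalIntegral_comp_comm hc

open Metric Real in
/-- Pythagoras' theorem: constants are orthogonal to holomorphic functions vanishing at `0`. -/
theorem circleAverage_norm_sq_const_add {φ : ℂ → ℂ} (hφ : DifferentiableOn ℂ φ (ball 0 1))
    (h0 : φ 0 = 0) (c : ℂ) {ρ : ℝ} (hρ0 : 0 ≤ ρ) (hρ1 : ρ < 1) :
    circleAverage (fun z => ‖c + φ z‖ ^ 2) 0 ρ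
      = ‖c‖ ^ 2 + circleAverage (fun z => ‖φ z‖ ^ 2) 0 ρ := by
  have hsub : sphere (0 : ℂ) |ρ| ⊆ ball 0 1 := sphere_subset_closedBall.trans <|
    closedBall_subset_ball (by rwa [abs_of_nonneg hρ0])
  have hφc := hφ.continuousOn.mono hsub
  have hpt : (fun z => ‖c + φ z‖ ^ 2)
      = fun z => (‖c‖ ^ 2 + ‖φ z‖ ^ 2) + (2 * (starRingEnd ℂ c) * φ z).re := by
    ext z
    rw [← Complex.normSq_eq_norm_sq, ← Complex.normSq_eq_norm_sq, ← Complex.normSq_eq_norm_sq,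
      Complex.normSq_add, add_right_inj, ← Complex.conj_re]
    simp
    ring
  rw [hpt, circleAverage_fun_add, circleAverage_re_eq_zero (by fun_prop) (by simp [h0]) hρ0 hρ1,
    circleAverage_fun_add, circleAverage_const, add_zero]
  all_goals exact ContinuousOn.circleIntegrable' (by fun_prop)

theorem taylorCoeff_zero (φ : ℂ → ℂ) : taylorCoeff φ 0 = φ 0 := by simp [taylorCoeff]

theorem taylorCoeff_succ (φ : ℂ → ℂ) (n : ℕ) :
    taylorCoeff φ (n + 1) = taylorCoeff (deriv φ) n / (n + 1) := by
  rw [taylorCoeff, taylorCoeff, iteratedDeriv_succ', Nat.factorial_succ, div_div]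
  push_cast
  ring

theorem Filter.EventuallyEq.taylorCoeff_eq {φ ψ : ℂ → ℂ} (h : φ =ᶠ[nhds 0] ψ) (n : ℕ) :
    taylorCoeff φ n = taylorCoeff ψ n := by
  rw [taylorCoeff, taylorCoeff, h.iteratedDeriv_eq]

/-- The Cauchy product formula for Taylor coefficients. -/
theorem taylorCoeff_mul {φ ψ : ℂ → ℂ} (hφ : AnalyticAt ℂ φ 0) (hψ : AnalyticAt ℂ ψ 0) (n : ℕ) :
    taylorCoeff (fun z => φ z * ψ z) n
      = ∑ i ∈ Finset.range (n + 1), taylorCoeff φ i * taylorCoeff ψ (n - i) := by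
  rw [taylorCoeff, iteratedDeriv_fun_mul hφ.contDiffAt hψ.contDiffAt, Finset.sum_div]
  refine Finset.sum_congr rfl fun i hi => ?_
  have hi : i ≤ n := Nat.lt_succ_iff.mp (Finset.mem_range.mp hi)
  rw [taylorCoeff, taylorCoeff, Nat.cast_choose ℂ hi]
  have := Nat.factorial_ne_zero n
  have := Nat.factorial_ne_zero i
  have := Nat.factorial_ne_zero (n - i)
  field_simp

theorem taylorCoeff_id_mul {φ : ℂ → ℂ} (hφ : AnalyticAt ℂ φ 0) (n : ℕ) :
    taylorCoeff (fun z => z * φ z) (n + 1) = taylorCoeff φ n := by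
  rw [taylorCoeff_mul (φ := fun z => z) analyticAt_id hφ, Finset.sum_eq_single 1]
  · simp [taylorCoeff, iteratedDeriv_fun_id_zero]
  · intro i _ hi
    simp [taylorCoeff, iteratedDeriv_fun_id_zero, hi]
  · intro h
    simp at h

theorem eq_add_mul_dslope (φ : ℂ → ℂ) (z : ℂ) : φ z = φ 0 + z * dslope φ 0 z := by
  have := sub_smul_dslope φ 0 z
  rw [sub_zero, smul_eq_mul] at this
  rw [this]
  ring

theorem taylorCoeff_succ_eq_dslope {φ : ℂ → ℂ} (hφ : DifferentiableOn ℂ φ (Metric.ball 0 1))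
    (n : ℕ) : taylorCoeff φ (n + 1) = taylorCoeff (dslope φ 0) n := by
  have hnhds : Metric.ball (0 : ℂ) 1 ∈ nhds 0 := Metric.ball_mem_nhds _ one_pos
  have hd : AnalyticAt ℂ (dslope φ 0) 0 :=
    ((Complex.differentiableOn_dslope hnhds).mpr hφ).analyticAt hnhds
  rw [← taylorCoeff_id_mul hd, taylorCoeff_succ, taylorCoeff_succ]
  congr 2
  conv_lhs => rw [funext (eq_add_mul_dslope φ)]
  ext z
  exact deriv_const_add _

/-- Bessel's inequality for the Taylor coefficients on a circle, by removing one coefficient at a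
time: `φ = φ 0 + z φ₁` with `φ 0` orthogonal to `z φ₁`. -/
theorem sum_norm_sq_taylorCoeff_le_circleAverage {ρ : ℝ} (hρ0 : 0 ≤ ρ) (hρ1 : ρ < 1) (N : ℕ)
    {φ : ℂ → ℂ} (hφ : DifferentiableOn ℂ φ (Metric.ball 0 1)) :
    ∑ n ∈ Finset.range N, ‖taylorCoeff φ n‖ ^ 2 * ρ ^ (2 * n)
      ≤ Real.circleAverage (fun z => ‖φ z‖ ^ 2) 0 ρ := by
  induction N generalizing φ with
  | zero =>
    rw [Finset.range_zero, Finset.sum_empty, Real.circleAverage, smul_eq_mul]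
    refine mul_nonneg (by positivity) ?_
    exact intervalIntegral.integral_nonneg (by positivity) fun _ _ => by positivity
  | succ N ih =>
    have hnhds : Metric.ball (0 : ℂ) 1 ∈ nhds 0 := Metric.ball_mem_nhds _ one_pos
    have hd : DifferentiableOn ℂ (dslope φ 0) (Metric.ball 0 1) :=
      (Complex.differentiableOn_dslope hnhds).mpr hφ
    have hcoeff := taylorCoeff_succ_eq_dslope hφ
    have heq : φ = fun z => φ 0 + z * dslope φ 0 z := funext fun z => eq_add_mul_dslope φ z
    rw [Finset.sum_range_succ', taylorCoeff_zero, mul_zero, pow_zero, mul_one]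
    simp_rw [hcoeff]
    conv_rhs => rw [heq]
    rw [circleAverage_norm_sq_const_add (by fun_prop) (by simp) _ hρ0 hρ1, add_comm]
    have hz : Real.circleAverage (fun z => ‖z * dslope φ 0 z‖ ^ 2) 0 ρ
        = ρ ^ 2 * Real.circleAverage (fun z => ‖dslope φ 0 z‖ ^ 2) 0 ρ := by
      rw [← smul_eq_mul, ← Real.circleAverage_fun_smul]
      refine Real.circleAverage_congr_sphere fun z hz => ?_
      rw [mem_sphere_zero_iff_norm, abs_of_nonneg hρ0] at hz
      simp [hz, mul_pow]
    rw [hz]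
    have := mul_le_mul_of_nonneg_left (ih hd) (sq_nonneg ρ)
    rw [Finset.mul_sum] at this
    refine add_le_add_right ((Finset.sum_congr rfl fun n _ => ?_).trans_le this) _
    ring

open Metric Real in
/-- The mean square of `-1/z² + φ` on a circle: the pole term is orthogonal to `φ`. -/
theorem circleAverage_norm_sq_pole_add {φ : ℂ → ℂ} (hφ : DifferentiableOn ℂ φ (ball 0 1))
    {ρ : ℝ} (hρ0 : 0 < ρ) (hρ1 : ρ < 1) :
    circleAverage (fun z => ‖-(z ^ 2)⁻¹ + φ z‖ ^ 2) 0 ρ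
      = (ρ ^ 4)⁻¹ + circleAverage (fun z => ‖φ z‖ ^ 2) 0 ρ := by
  have key := circleAverage_norm_sq_const_add (φ := fun z => z ^ 2 * φ z) (by fun_prop) (by simp)
    (-1) hρ0.le hρ1
  have h1 : circleAverage (fun z => ‖-1 + z ^ 2 * φ z‖ ^ 2) 0 ρ
      = ρ ^ 4 * circleAverage (fun z => ‖-(z ^ 2)⁻¹ + φ z‖ ^ 2) 0 ρ := by
    rw [← smul_eq_mul, ← circleAverage_fun_smul]
    refine circleAverage_congr_sphere fun z hz => ?_
    rw [mem_sphere_zero_iff_norm, abs_of_pos hρ0] at hz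
    have hz0 : z ≠ 0 := norm_ne_zero_iff.mp (hz ▸ hρ0.ne')
    have : -1 + z ^ 2 * φ z = z ^ 2 * (-(z ^ 2)⁻¹ + φ z) := by field_simp
    simp only [this, norm_mul, norm_pow, hz, smul_eq_mul]
    ring
  have h2 : circleAverage (fun z => ‖z ^ 2 * φ z‖ ^ 2) 0 ρ
      = ρ ^ 4 * circleAverage (fun z => ‖φ z‖ ^ 2) 0 ρ := by
    rw [← smul_eq_mul, ← circleAverage_fun_smul]
    refine circleAverage_congr_sphere fun z hz => ?_
    rw [mem_sphere_zero_iff_norm, abs_of_pos hρ0] at hz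
    simp only [norm_mul, norm_pow, hz, smul_eq_mul]
    ring
  rw [h1, h2, norm_neg, norm_one, one_pow] at key
  rw [← mul_right_inj' (pow_ne_zero 4 hρ0.ne'), key, mul_add,
    mul_inv_cancel₀ (pow_ne_zero 4 hρ0.ne')]

/-! ### The area of the image of an annulus -/

open MeasureTheory Set Real in
/-- Integration over an annulus in polar coordinates, in terms of circle averages. -/
theorem lintegral_annulus {g : ℂ → ℝ} (hg : Measurable g) (hg0 : ∀ z, 0 ≤ g z) {ε r : ℝ}
    (hε : 0 < ε) (hgc : ContinuousOn g {z | ‖z‖ ∈ Ioo ε r}) :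
    ∫⁻ z in {z : ℂ | ‖z‖ ∈ Ioo ε r}, ENNReal.ofReal (g z)
      = ∫⁻ ρ in Ioo ε r, ENNReal.ofReal (2 * π * ρ * circleAverage g 0 ρ) := by
  have hA : MeasurableSet {z : ℂ | ‖z‖ ∈ Ioo ε r} := measurable_norm measurableSet_Ioo
  have hsymm : Measurable (fun p : ℝ × ℝ => Complex.polarCoord.symm p) := by
    simp only [Complex.polarCoord_symm_apply]
    fun_prop
  have hmeas : Measurable
      ({z : ℂ | ‖z‖ ∈ Ioo ε r}.indicator (fun z => ENNReal.ofReal (g z))) :=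
    hg.ennreal_ofReal.indicator hA
  rw [← lintegral_indicator hA, ← Complex.lintegral_comp_polarCoord_symm,
    polarCoord_target, Measure.volume_eq_prod, ← Measure.prod_restrict,
    lintegral_prod _ (by
      simp only [smul_eq_mul]
      exact ((ENNReal.measurable_ofReal.comp measurable_fst).mul
        (hmeas.comp hsymm)).aemeasurable)]
  have hres : volume.restrict (Ioo ε r) = (volume.restrict (Ioi 0)).restrict (Ioo ε r) := by
    rw [Measure.restrict_restrict measurableSet_Ioo,
      inter_eq_self_of_subset_left (Ioo_subset_Ioi_self.trans (Ioi_subset_Ioi hε.le))]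
  rw [hres, ← lintegral_indicator measurableSet_Ioo]
  refine setLIntegral_congr_fun measurableSet_Ioi fun ρ hρ => ?_
  have hρ : 0 < ρ := hρ
  have hnorm (θ : ℝ) : ‖Complex.polarCoord.symm (ρ, θ)‖ = ρ := by
    rw [Complex.norm_polarCoord_symm, abs_of_pos hρ]
  by_cases hmem : ρ ∈ Ioo ε r
  · rw [indicator_of_mem hmem]
    have hcirc (θ : ℝ) : Complex.polarCoord.symm (ρ, θ) = circleMap 0 ρ θ := by
      rw [Complex.polarCoord_symm_apply, circleMap_zero, Complex.exp_mul_I]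
      push_cast
      rfl
    have hcont : Continuous fun θ => g (circleMap 0 ρ θ) := by
      refine hgc.comp_continuous (continuous_circleMap 0 ρ) fun θ => ?_
      rw [mem_ofPred_eq, ← hcirc, hnorm]
      exact hmem
    have hind (θ : ℝ) : {z : ℂ | ‖z‖ ∈ Ioo ε r}.indicator (fun z => ENNReal.ofReal (g z))
        (Complex.polarCoord.symm (ρ, θ)) = ENNReal.ofReal (g (circleMap 0 ρ θ)) := by
      rw [indicator_of_mem (by rw [mem_ofPred_eq, hnorm]; exact hmem), hcirc]
    simp only [hind, smul_eq_mul]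
    rw [lintegral_const_mul _ hcont.measurable.ennreal_ofReal,
      Measure.restrict_congr_set Ioo_ae_eq_Ioc,
      ← ofReal_integral_eq_lintegral_ofReal
        (hcont.integrableOn_Ioc) (.of_forall fun θ => hg0 _),
      ← ENNReal.ofReal_mul hρ.le, ← intervalIntegral.integral_of_le (by linarith [pi_pos]),
      circleAverage_eq_integral_add (-π),
      intervalIntegral.integral_comp_add_right (fun θ => g (circleMap 0 ρ θ)), smul_eq_mul]
    congr 1
    rw [zero_add, show 2 * π + -π = π by ring]
    field_simp
  · rw [indicator_of_notMem hmem]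
    have hind (θ : ℝ) : {z : ℂ | ‖z‖ ∈ Ioo ε r}.indicator (fun z => ENNReal.ofReal (g z))
        (Complex.polarCoord.symm (ρ, θ)) = 0 :=
      indicator_of_notMem (by rw [mem_ofPred_eq, hnorm]; exact hmem) _
    simp only [hind, smul_zero, lintegral_zero]

open MeasureTheory Set in
/-- The area of the image of an injective holomorphic map is the integral of `‖F'‖²`. -/
theorem volume_image_eq_lintegral_norm_deriv_sq {F F' : ℂ → ℂ} {A : Set ℂ}
    (hA : MeasurableSet A) (hF : ∀ z ∈ A, HasDerivAt F (F' z) z) (hinj : InjOn F A) :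
    volume (F '' A) = ∫⁻ z in A, ENNReal.ofReal (‖F' z‖ ^ 2) := by
  rw [← lintegral_abs_det_fderiv_eq_addHaar_image volume hA
    (fun z hz => ((hF z hz).hasFDerivAt.restrictScalars ℝ).hasFDerivWithinAt) hinj]
  refine setLIntegral_congr_fun hA fun z _ => ?_
  simp [ContinuousLinearMap.det, LinearMap.det_restrictScalars, Algebra.norm_complex_eq,
    Complex.normSq_eq_norm_sq]

theorem integral_area_density {ε r : ℝ} (hε : 0 < ε) (hεr : ε ≤ r) (N : ℕ) (c : ℕ → ℝ) :
    ∫ ρ in ε..r, 2 * Real.pi * ρ *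
        ((ρ ^ 4)⁻¹ + ∑ n ∈ Finset.range N, ((n + 1) ^ 2 * c n) * ρ ^ (2 * n))
      = Real.pi * ((ε ^ 2)⁻¹ - (r ^ 2)⁻¹
        + ∑ n ∈ Finset.range N, (n + 1) * c n * (r ^ (2 * n + 2) - ε ^ (2 * n + 2))) := by
  have hpos {ρ : ℝ} (hρ : ρ ∈ Set.uIcc ε r) : ρ ≠ 0 := by
    rw [Set.uIcc_of_le hεr] at hρ
    exact (hε.trans_le hρ.1).ne'
  rw [intervalIntegral.integral_eq_sub_of_hasDerivAt (f := fun ρ => Real.pi * (-(ρ ^ 2)⁻¹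
    + ∑ n ∈ Finset.range N, (n + 1) * c n * ρ ^ (2 * n + 2)))]
  · simp only [mul_sub, Finset.sum_sub_distrib]
    ring
  · intro ρ hρ
    have h0 := hpos hρ
    have h1 := (((hasDerivAt_pow 2 ρ).inv (pow_ne_zero 2 h0)).neg.add
      (HasDerivAt.fun_sum (u := Finset.range N) fun n _ =>
        (hasDerivAt_pow (2 * n + 2) ρ).const_mul ((n + 1) * c n))).const_mul Real.pi
    convert! h1 using 1
    rw [mul_add, mul_add, Finset.mul_sum, Finset.mul_sum]
    congr 1
    · field_simp
      norm_num
    · refine Finset.sum_congr rfl fun n _ => ?_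
      rw [show 2 * n + 2 - 1 = 2 * n + 1 by omega]
      push_cast
      ring
  · refine ContinuousOn.intervalIntegrable ?_
    refine ContinuousOn.mul (by fun_prop) (ContinuousOn.add ?_ (by fun_prop))
    exact ContinuousOn.inv₀ (by fun_prop) fun ρ hρ => pow_ne_zero 4 (hpos hρ)

open MeasureTheory Set in
/-- Lower bound for the area of the image of an annulus under an injective `1/z + h`. -/
theorem le_volume_image_annulus {h : ℂ → ℂ} (hh : DifferentiableOn ℂ h (Metric.ball 0 1))
    (hinj : InjOn (fun z => z⁻¹ + h z) (Metric.ball 0 1 \ {0})) {ε r : ℝ} (hε : 0 < ε)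
    (hεr : ε ≤ r) (hr : r < 1) (N : ℕ) :
    ENNReal.ofReal (Real.pi * ((ε ^ 2)⁻¹ - (r ^ 2)⁻¹ + ∑ n ∈ Finset.range N,
        (n + 1) * ‖taylorCoeff h (n + 1)‖ ^ 2 * (r ^ (2 * n + 2) - ε ^ (2 * n + 2))))
      ≤ volume ((fun z => z⁻¹ + h z) '' {z | ‖z‖ ∈ Ioo ε r}) := by
  have hA : MeasurableSet {z : ℂ | ‖z‖ ∈ Ioo ε r} := measurable_norm measurableSet_Ioo
  have hsub : {z : ℂ | ‖z‖ ∈ Ioo ε r} ⊆ Metric.ball 0 1 \ {0} := fun z hz =>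
    ⟨mem_ball_zero_iff.mpr (hz.2.trans hr), norm_pos_iff.mp (hε.trans hz.1)⟩
  have hd : DifferentiableOn ℂ (deriv h) (Metric.ball 0 1) := hh.deriv Metric.isOpen_ball
  rw [volume_image_eq_lintegral_norm_deriv_sq (F := fun z => z⁻¹ + h z)
    (F' := fun z => -(z ^ 2)⁻¹ + deriv h z) hA
    (fun z hz => (hasDerivAt_inv (hsub hz).2).add
      (hh.differentiableAt (Metric.isOpen_ball.mem_nhds (hsub hz).1)).hasDerivAt)
    (hinj.mono hsub)]
  rw [lintegral_annulus (g := fun z => ‖-(z ^ 2)⁻¹ + deriv h z‖ ^ 2) _ (fun _ => by positivity) hε]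
  · rw [← integral_area_density hε hεr N, intervalIntegral.integral_of_le hεr,
      integral_Ioc_eq_integral_Ioo, ofReal_integral_eq_lintegral_ofReal]
    · refine setLIntegral_mono' measurableSet_Ioo fun ρ hρ => ENNReal.ofReal_le_ofReal ?_
      have hρ0 : 0 < ρ := hε.trans hρ.1
      have hρ1 : ρ < 1 := hρ.2.trans hr
      rw [circleAverage_norm_sq_pole_add hd hρ0 hρ1]
      refine mul_le_mul_of_nonneg_left (add_le_add_right ?_ _) (by positivity)
      refine le_trans (Finset.sum_congr rfl fun n _ => ?_).le
        (sum_norm_sq_taylorCoeff_le_circleAverage hρ0.le hρ1 N hd)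
      have hn : (n + 1 : ℂ) ≠ 0 := Nat.cast_add_one_ne_zero n
      rw [taylorCoeff_succ, norm_div, div_pow, show ‖(n + 1 : ℂ)‖ = n + 1 by
        exact_mod_cast Complex.norm_natCast (n + 1)]
      field_simp
    · refine IntegrableOn.mono_set (t := Icc ε r) ?_ Ioo_subset_Icc_self
      refine ContinuousOn.integrableOn_Icc ?_
      refine ContinuousOn.mul (by fun_prop) (ContinuousOn.add ?_ (by fun_prop))
      exact ContinuousOn.inv₀ (by fun_prop) fun ρ hρ => pow_ne_zero 4 (hε.trans_le hρ.1).ne'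
    · refine (ae_restrict_iff' measurableSet_Ioo).mpr (.of_forall fun ρ hρ => ?_)
      have hρ0 : 0 < ρ := hε.trans hρ.1
      positivity
  · refine ContinuousOn.pow (ContinuousOn.norm (ContinuousOn.add ?_ ?_)) 2
    · exact (ContinuousOn.inv₀ (by fun_prop) fun z hz => pow_ne_zero 2 (hsub hz).2).neg
    · exact hd.continuousOn.mono (hsub.trans sdiff_subset)
  · have := measurable_deriv h
    fun_prop

/-! ### The area theorem -/

/-- The real-linear map `w ↦ w - c * conj w`. -/
noncomputable def subMulConj (c : ℂ) : ℂ →ₗ[ℝ] ℂ :=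
  LinearMap.id - LinearMap.mulLeft ℝ c ∘ₗ Complex.conjAe.toLinearMap

theorem subMulConj_apply (c w : ℂ) : subMulConj c w = w - c * starRingEnd ℂ w := by
  simp [subMulConj]

theorem det_subMulConj (c : ℂ) : LinearMap.det (subMulConj c) = 1 - ‖c‖ ^ 2 := by
  rw [← LinearMap.det_toMatrix Complex.basisOneI, Matrix.det_fin_two,
    ← Complex.normSq_eq_norm_sq, Complex.normSq_apply]
  simp [LinearMap.toMatrix_apply, subMulConj_apply]
  ring

/-- The elementary estimate behind the containment of the sheared image in a disc. -/
theorem inv_add_le_inv_add {B M ε t : ℝ} (hB : 0 ≤ B) (hM : 0 ≤ M) (hε : 0 < ε)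
    (hε1 : ε * (2 * B + 2 * M + 1) ≤ 1) (hεt : ε ≤ t) (ht : t ≤ 1) :
    t⁻¹ + B * (t - ε ^ 2 / t) + M * t ^ 2 + ε ^ 2 * B * (B * t + M * t ^ 2)
      ≤ ε⁻¹ + (M + B * (B + M)) * ε ^ 2 := by
  have ht0 : 0 < t := hε.trans_le hεt
  have hd : 0 ≤ t - ε := sub_nonneg.mpr hεt
  have h1 : ε⁻¹ - t⁻¹ = (t - ε) / (ε * t) := by field_simp
  have h2 : (t - ε) * (2 * B + 2 * M) ≤ (t - ε) / (ε * t) := by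
    rw [le_div_iff₀ (by positivity), mul_assoc]
    refine mul_le_of_le_one_right hd ?_
    have : (2 * B + 2 * M) * (ε * t) ≤ (2 * B + 2 * M) * ε := by
      gcongr
      exact mul_le_of_le_one_right hε.le ht
    nlinarith
  have h3 : t - ε ^ 2 / t ≤ 2 * (t - ε) := by
    have : 2 * (t - ε) - (t - ε ^ 2 / t) = (t - ε) ^ 2 / t := by
      field_simp
      ring
    have : 0 ≤ (t - ε) ^ 2 / t := by positivity
    linarith
  have h4 : t ^ 2 ≤ ε ^ 2 + 2 * (t - ε) := by nlinarith
  have h5 : B * t + M * t ^ 2 ≤ B + M := by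
    have : t ^ 2 ≤ 1 := pow_le_one₀ ht0.le ht
    nlinarith
  have h6 := mul_le_mul_of_nonneg_left h3 hB
  have h7 := mul_le_mul_of_nonneg_left h4 hM
  have h8 := mul_le_mul_of_nonneg_left h5 (by positivity : 0 ≤ ε ^ 2 * B)
  linarith

open Metric Set in
/-- The map `w ↦ w - ε² b conj w`, with `b = h'(0)`, turns the image of the circle `‖z‖ = ε` into
a circle up to an error `O(ε²)`. -/
theorem mapsTo_subMulConj_annulus {h : ℂ → ℂ} (hh : DifferentiableOn ℂ h (ball 0 1)) {r : ℝ}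
    (hr : r < 1) :
    ∃ C : ℝ, 0 ≤ C ∧ ∃ δ : ℝ, 0 < δ ∧ ∀ ε : ℝ, 0 < ε → ε < δ →
      MapsTo (fun z => subMulConj (ε ^ 2 * deriv h 0) (z⁻¹ + h z)) {z | ‖z‖ ∈ Ioo ε r}
        (closedBall (subMulConj (ε ^ 2 * deriv h 0) (h 0)) (ε⁻¹ + C * ε ^ 2)) := by
  have hnhds : ball (0 : ℂ) 1 ∈ nhds 0 := ball_mem_nhds _ one_pos
  set b := deriv h 0
  set k := dslope (dslope h 0) 0
  have hk : DifferentiableOn ℂ k (ball 0 1) :=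
    (Complex.differentiableOn_dslope hnhds).mpr ((Complex.differentiableOn_dslope hnhds).mpr hh)
  have heq (z : ℂ) : h z = h 0 + (b * z + z ^ 2 * k z) := by
    have h2 := eq_add_mul_dslope (dslope h 0) z
    rw [dslope_same] at h2
    linear_combination eq_add_mul_dslope h z + z * h2
  obtain ⟨M, hM⟩ := (isCompact_closedBall (0 : ℂ) r).exists_bound_of_continuousOn
    (hk.continuousOn.mono (closedBall_subset_ball hr))
  have hM (z : ℂ) (hz : ‖z‖ ≤ r) : ‖k z‖ ≤ |M| :=
    (hM z (mem_closedBall_zero_iff.mpr hz)).trans (le_abs_self M)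
  refine ⟨|M| + ‖b‖ * (‖b‖ + |M|), by positivity, (2 * ‖b‖ + 2 * |M| + 1)⁻¹, by positivity, ?_⟩
  intro ε hε hεδ z hz
  have hεz : ε < ‖z‖ := hz.1
  have hz0 : z ≠ 0 := norm_pos_iff.mp (hε.trans hεz)
  have hkz := hM z hz.2.le
  rw [mem_closedBall, dist_eq_norm, ← map_sub]
  refine le_trans ?_ (inv_add_le_inv_add (norm_nonneg b) (abs_nonneg M) hε
    ?_ hεz.le (hz.2.trans hr).le)
  · have hsplit : subMulConj (ε ^ 2 * b) (z⁻¹ + h z - h 0)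
        = z⁻¹ + b * (z - ε ^ 2 / starRingEnd ℂ z) + z ^ 2 * k z
          - ε ^ 2 * b * starRingEnd ℂ (b * z + z ^ 2 * k z) := by
      rw [heq z, subMulConj_apply]
      simp only [map_add, map_sub, map_inv₀]
      ring
    have hfactor : z - ε ^ 2 / starRingEnd ℂ z
        = ((‖z‖ - ε ^ 2 / ‖z‖ : ℝ) : ℂ) * (z / ‖z‖) := by
      have hconj0 : starRingEnd ℂ z ≠ 0 := (map_ne_zero _).mpr hz0
      have hn : (‖z‖ : ℂ) ≠ 0 := by simpa using hz0
      have := Complex.mul_conj' z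
      push_cast
      field_simp
      linear_combination (ε ^ 2 : ℂ) * this
    have hnn : 0 ≤ ‖z‖ - ε ^ 2 / ‖z‖ := by
      rw [sub_nonneg, div_le_iff₀ (hε.trans hεz)]
      nlinarith
    have hnorm : ‖z - ε ^ 2 / starRingEnd ℂ z‖ = ‖z‖ - ε ^ 2 / ‖z‖ := by
      rw [hfactor, norm_mul, Complex.norm_real, Real.norm_of_nonneg hnn, norm_div,
        Complex.norm_real, norm_norm, div_self (hε.trans hεz).ne', mul_one]
    have hquad : ‖z ^ 2 * k z‖ ≤ |M| * ‖z‖ ^ 2 := by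
      rw [norm_mul, norm_pow, mul_comm]
      gcongr
    rw [hsplit]
    refine (norm_sub_le _ _).trans (add_le_add ((norm_add₃_le).trans (add_le_add
      (add_le_add (norm_inv z).le ?_) hquad)) ?_)
    · rw [norm_mul, hnorm]
    · rw [norm_mul, norm_mul, norm_pow, Complex.norm_real, Real.norm_of_nonneg hε.le,
        RCLike.norm_conj]
      gcongr
      exact (norm_add_le _ _).trans (add_le_add (norm_mul _ _).le hquad)
  · rw [← le_div_iff₀ (by positivity), one_div]
    exact hεδ.le

open Metric Set MeasureTheory in
/-- **Gronwall's area theorem**, for finitely many coefficients. -/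
theorem sum_mul_norm_sq_taylorCoeff_le_one {h : ℂ → ℂ} (hh : DifferentiableOn ℂ h (ball 0 1))
    (hinj : InjOn (fun z => z⁻¹ + h z) (ball 0 1 \ {0})) (N : ℕ) :
    ∑ n ∈ Finset.range N, (n + 1) * ‖taylorCoeff h (n + 1)‖ ^ 2 ≤ 1 := by
  set S : ℝ → ℝ := fun ρ =>
    ∑ n ∈ Finset.range N, (n + 1) * ‖taylorCoeff h (n + 1)‖ ^ 2 * ρ ^ (2 * n + 2) with hS
  have hScont : Continuous S := by fun_prop
  set B := ‖deriv h 0‖ ^ 2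
  suffices H : ∀ r : ℝ, 0 < r → r < 1 → S r ≤ (r ^ 2)⁻¹ by
    have hlim : Filter.Tendsto (fun r : ℝ => (r ^ 2)⁻¹ - S r) (nhdsWithin 1 (Iio 1))
        (nhds ((1 ^ 2)⁻¹ - S 1)) := by
      refine Filter.Tendsto.mono_left (ContinuousAt.tendsto ?_) nhdsWithin_le_nhds
      exact ((continuousAt_id.pow 2).inv₀ (by simp)).sub hScont.continuousAt
    have := ge_of_tendsto hlim (b := 0) <| by
      filter_upwards [Ioo_mem_nhdsLT zero_lt_one] with r hr
      exact sub_nonneg.mpr (H r hr.1 hr.2)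
    simpa [hS] using this
  intro r hr0 hr1
  obtain ⟨C, hC0, δ, hδ, hC⟩ := mapsTo_subMulConj_annulus hh hr1
  -- The terms `ε⁻²` of the two area estimates cancel, which leaves an error
  -- continuous in `ε` and equal to `0` at `0`.
  have key (ε : ℝ) (hε : 0 < ε) (hεδ : ε < δ) (hεr : ε < r) (hεB : ε ^ 4 * B < 1) :
      (1 - ε ^ 4 * B) * (S r - (r ^ 2)⁻¹ - S ε)
        ≤ 2 * C * ε + C ^ 2 * ε ^ 4 + ε ^ 2 * B := by
    have hlow := le_volume_image_annulus hh hinj hε hεr.le hr1 N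
    have hup := measure_mono (μ := volume) (hC ε hε hεδ).image_subset
    rw [← Function.comp_def (subMulConj _) (fun z => z⁻¹ + h z), image_comp,
      Measure.addHaar_image_linearMap, det_subMulConj, Complex.volume_closedBall] at hup
    have hdet : 1 - ‖(ε : ℂ) ^ 2 * deriv h 0‖ ^ 2 = 1 - ε ^ 4 * B := by
      rw [norm_mul, norm_pow, Complex.norm_real, Real.norm_of_nonneg hε.le]
      ring
    rw [hdet, abs_of_pos (sub_pos.mpr hεB)] at hup
    have hvol := (mul_le_mul_right hlow (ENNReal.ofReal (1 - ε ^ 4 * B))).trans hup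
    rw [← ENNReal.ofReal_mul (sub_pos.mpr hεB).le, ← ENNReal.ofReal_pow (by positivity),
      ← ENNReal.ofReal_coe_nnreal, ← ENNReal.ofReal_mul (by positivity), NNReal.coe_real_pi,
      ENNReal.ofReal_le_ofReal_iff (by positivity)] at hvol
    have hsum : ∑ n ∈ Finset.range N, (n + 1) * ‖taylorCoeff h (n + 1)‖ ^ 2
        * (r ^ (2 * n + 2) - ε ^ (2 * n + 2)) = S r - S ε := by
      simp only [hS, mul_sub, Finset.sum_sub_distrib]
    rw [hsum] at hvol
    have hvol' : (1 - ε ^ 4 * B) * ((ε ^ 2)⁻¹ - (r ^ 2)⁻¹ + (S r - S ε))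
        ≤ (ε⁻¹ + C * ε ^ 2) ^ 2 :=
      le_of_mul_le_mul_right (by linarith) Real.pi_pos
    have hcancel : (ε⁻¹ + C * ε ^ 2) ^ 2 - (1 - ε ^ 4 * B) * (ε ^ 2)⁻¹
        = 2 * C * ε + C ^ 2 * ε ^ 4 + ε ^ 2 * B := by
      field_simp
      ring
    linarith
  have hleft : Filter.Tendsto (fun ε : ℝ => (1 - ε ^ 4 * B) * (S r - (r ^ 2)⁻¹ - S ε))
      (nhdsWithin 0 (Ioi 0)) (nhds ((1 - 0 ^ 4 * B) * (S r - (r ^ 2)⁻¹ - S 0))) :=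
    (Continuous.tendsto (by fun_prop) 0).mono_left nhdsWithin_le_nhds
  have hright : Filter.Tendsto (fun ε : ℝ => 2 * C * ε + C ^ 2 * ε ^ 4 + ε ^ 2 * B)
      (nhdsWithin 0 (Ioi 0)) (nhds (2 * C * 0 + C ^ 2 * 0 ^ 4 + 0 ^ 2 * B)) :=
    (Continuous.tendsto (by fun_prop) 0).mono_left nhdsWithin_le_nhds
  have hsmall : ∀ᶠ ε : ℝ in nhdsWithin 0 (Ioi 0), ε ^ 4 * B < 1 :=
    nhdsWithin_le_nhds <| Continuous.tendsto (f := fun ε : ℝ => ε ^ 4 * B) (by fun_prop) 0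
      |>.eventually_lt_const (by simp)
  have hle := le_of_tendsto_of_tendsto hleft hright <| by
    filter_upwards [hsmall, Ioo_mem_nhdsGT hδ, Ioo_mem_nhdsGT hr0] with ε h1 h2 h3
    exact key ε h2.1 h2.2 h3.2 h1
  have hS0 : S 0 = 0 := by simp [hS]
  rw [hS0] at hle
  linarith

/-! ### Univalent functions with vanishing second coefficient -/

open Metric in
/-- The area theorem for `1/f`, where `a₂ = 0`: then
`1/f(z) = 1/z - a₃ z - a₄ z² + (a₃² - a₅) z³ + ⋯`. -/
theorem ClassS.area_inequality {f : ℂ → ℂ} (hf : ClassS f) (ha2 : taylorCoeff f 2 = 0) :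
    ‖taylorCoeff f 3‖ ^ 2 + 2 * ‖taylorCoeff f 4‖ ^ 2
      + 3 * ‖taylorCoeff f 5 - taylorCoeff f 3 ^ 2‖ ^ 2 ≤ 1 := by
  have hnhds : ball (0 : ℂ) 1 ∈ nhds 0 := ball_mem_nhds _ one_pos
  set g := dslope f 0 with hgdef
  have hg : DifferentiableOn ℂ g (ball 0 1) :=
    (Complex.differentiableOn_dslope hnhds).mpr hf.analytic
  have hfg (z : ℂ) : f z = z * g z := by
    rw [eq_add_mul_dslope f z, hf.map_zero, zero_add]
  have hg0 : g 0 = 1 := by rw [hgdef, dslope_same, hf.deriv_zero]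
  have hgne : ∀ z ∈ ball (0 : ℂ) 1, g z ≠ 0 := by
    intro z hz h0
    rcases eq_or_ne z 0 with rfl | hz0
    · simp [hg0] at h0
    · exact hz0 (hf.univalent hz (mem_ball_self one_pos) (by rw [hfg z, h0, hf.map_zero, mul_zero]))
  set u : ℂ → ℂ := fun z => (g z)⁻¹ with hudef
  have hu : DifferentiableOn ℂ u (ball 0 1) := hg.inv hgne
  have hu0 : u 0 = 1 := by rw [hudef]; simp [hg0]
  set h := dslope u 0
  have hh : DifferentiableOn ℂ h (ball 0 1) := (Complex.differentiableOn_dslope hnhds).mpr hu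
  have hFf : ∀ z ∈ ball (0 : ℂ) 1 \ {0}, z⁻¹ + h z = (f z)⁻¹ := by
    intro z hz
    have hz0 : z ≠ 0 := hz.2
    have h1 := eq_add_mul_dslope u z
    rw [hu0] at h1
    rw [hfg, mul_inv, show (g z)⁻¹ = 1 + z * h z from h1, mul_add, ← mul_assoc,
      inv_mul_cancel₀ hz0, mul_one, one_mul]
  have hinj : Set.InjOn (fun z => z⁻¹ + h z) (ball 0 1 \ {0}) := by
    intro z hz w hw hzw
    simp only [hFf z hz, hFf w hw] at hzw
    exact hf.univalent hz.1 hw.1 (inv_injective hzw)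
  have harea := sum_mul_norm_sq_taylorCoeff_le_one hh hinj 3
  -- Compare coefficients in `g * u = 1`.
  have hgu (n : ℕ) : ∑ i ∈ Finset.range (n + 1 + 1), taylorCoeff g i * taylorCoeff u (n + 1 - i)
      = 0 := by
    have h1 : (fun z => g z * u z) =ᶠ[nhds 0] fun _ => 1 := by
      filter_upwards [hnhds] with z hz
      exact mul_inv_cancel₀ (hgne z hz)
    rw [← taylorCoeff_mul (hg.analyticAt hnhds) (hu.analyticAt hnhds), h1.taylorCoeff_eq]
    simp [taylorCoeff, iteratedDeriv_const]
  have hgn (n : ℕ) : taylorCoeff g n = taylorCoeff f (n + 1) :=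
    (taylorCoeff_succ_eq_dslope hf.analytic n).symm
  have ha1 : taylorCoeff f 1 = 1 := by rw [← hgn 0, taylorCoeff_zero, hg0]
  have e1 := hgu 0
  have e2 := hgu 1
  have e3 := hgu 2
  have e4 := hgu 3
  simp only [hgn, Finset.sum_range_succ, Finset.range_zero, Finset.sum_empty, Nat.reduceAdd,
    Nat.reduceSub, zero_add, ha1, ha2, taylorCoeff_zero, hu0, one_mul, zero_mul, add_zero,
    mul_one] at e1 e2 e3 e4
  have u2 : taylorCoeff u 2 = -taylorCoeff f 3 := by linear_combination e2
  have u3 : taylorCoeff u 3 = -taylorCoeff f 4 := by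
    linear_combination e3 - taylorCoeff f 3 * e1
  have u4 : taylorCoeff u 4 = -(taylorCoeff f 5 - taylorCoeff f 3 ^ 2) := by
    rw [u2, e1] at e4
    linear_combination e4
  have hhn (n : ℕ) : taylorCoeff h n = taylorCoeff u (n + 1) :=
    (taylorCoeff_succ_eq_dslope hu n).symm
  simp only [Finset.sum_range_succ, Finset.range_zero, Finset.sum_empty, hhn, Nat.reduceAdd,
    zero_add, u2, u3, u4, norm_neg] at harea
  norm_num at harea
  linarith

theorem toeplitzDet_three (n : ℕ) (f : ℂ → ℂ) :
    toeplitzDet 3 n f = (taylorCoeff f n - taylorCoeff f (n + 2)) *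
      (taylorCoeff f n ^ 2 + taylorCoeff f n * taylorCoeff f (n + 2)
        - 2 * taylorCoeff f (n + 1) ^ 2) := by
  rw [toeplitzDet, Matrix.det_fin_three]
  simp
  ring

theorem theorem4 (f : ℂ → ℂ) (hf : ClassS f) (ha2 : taylorCoeff f 2 = 0) :
    ‖toeplitzDet 3 2 f‖ ≤ (4 / 3 : ℝ) ∧ ‖toeplitzDet 3 3 f‖ ≤ (7.3883 : ℝ) := by
  have harea := hf.area_inequality ha2
  rw [toeplitzDet_three, toeplitzDet_three, ha2]
  simp only [Nat.reduceAdd]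
  generalize taylorCoeff f 3 = a at *
  generalize taylorCoeff f 4 = b at *
  -- The area inequality controls `v = a₅ - a₃²` rather than `a₅` itself.
  obtain ⟨v, hv⟩ : ∃ v, taylorCoeff f 5 = a ^ 2 + v := ⟨_, (add_sub_cancel _ _).symm⟩
  rw [hv] at harea ⊢
  rw [add_sub_cancel_left] at harea
  have ha0 := norm_nonneg a
  have hb0 := norm_nonneg b
  have hv0 := norm_nonneg v
  have ha : ‖a‖ ≤ 1 := by nlinarith
  -- `3 / 4` and `29 / 50` round up `1 / √2` and `1 / √3`.
  have hb : ‖b‖ ≤ 3 / 4 := by nlinarith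
  have hv : ‖v‖ ≤ 29 / 50 := by nlinarith
  have hab : ‖a‖ ^ 2 + 2 * ‖b‖ ^ 2 ≤ 1 := by nlinarith
  have ha2 : ‖a‖ ^ 2 ≤ 1 := pow_le_one₀ ha0 ha
  constructor
  · have heq : (0 - b) * (0 ^ 2 + 0 * b - 2 * a ^ 2) = 2 * a ^ 2 * b := by ring
    rw [heq, norm_mul, norm_mul, norm_pow, RCLike.norm_ofNat]
    nlinarith [mul_nonneg hb0 (sub_nonneg.mpr ha2), sq_nonneg (‖b‖ - 1 / 2)]
  -- Both factors are at most `2 + 1 / √3 < 129 / 50`, and `(129 / 50) ^ 2 < 7.3883`.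
  · have h1 : ‖a - (a ^ 2 + v)‖ ≤ 129 / 50 := by
      refine (norm_sub_le _ _).trans ?_
      have := norm_add_le (a ^ 2) v
      rw [norm_pow] at this
      linarith
    have h2 : ‖a ^ 2 + a * (a ^ 2 + v) - 2 * b ^ 2‖ ≤ 129 / 50 := by
      have hcub : ‖a * (a ^ 2 + v)‖ ≤ 79 / 50 := by
        rw [norm_mul]
        have := norm_add_le (a ^ 2) v
        rw [norm_pow] at this
        nlinarith [norm_nonneg (a ^ 2 + v)]
      have hb2 : ‖2 * b ^ 2‖ = 2 * ‖b‖ ^ 2 := by simp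
      have h3 := norm_sub_le (a ^ 2 + a * (a ^ 2 + v)) (2 * b ^ 2)
      have h4 := norm_add_le (a ^ 2) (a * (a ^ 2 + v))
      rw [norm_pow] at h4
      linarith
    rw [norm_mul]
    refine (mul_le_mul h1 h2 (norm_nonneg _) (by norm_num)).trans (by norm_num)
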